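/- A Motzkin path of length $n$ is a lattice path in $\mathbb{Z}\times\mathbb{Z}$ with $n$ steps, each equal to $U=(1,1)$, $H=(1,0)$ or $D=(1,-1)$, that starts at the origin, ends on the $x$-axis and never goes below the $x$-axis. Let $\mathcal{M}_n$ be the set of Motzkin paths of length $n$, partially ordered by $\gamma_1\le\gamma_2$ if and only if $\gamma_1$ lies weakly below $\gamma_2$ (the $n$-th Motzkin lattice), and let $M_n=|\mathcal{M}_n|$ be the $n$-th Motzkin number. For a finite poset $P$ let $\ell(P)$ be the number of edges of its Hasse diagram (the number of pairs $(x,y)$ such that $y$ covers $x$) and let $i(P)=\ell(P)/|P|$ be its Hasse index. Let $\binom{n;\,3}{k}$ be the coefficient of $x^k$ in $(1+x+x^2)^n$, and put $T(x)=\sum_{n\ge0}\binom{n;\,3}{n}x^n$ and $M(x)=\sum_{n\ge0}M_nx^n$. **Theorem.** The edge generating series $\ell_{\mathcal M}(x)=\sum_{n\ge0}\ell(\mathcal{M}_n)x^n$ of the Motzkin lattices is $$\ell_{\mathcal M}(x)=\frac{(1+x)\left(1-2x-x^2-(1-x)\sqrt{1-2x-3x^2}\right)}{2x^2\sqrt{1-2x-3x^2}}=(1+x)\bigl(T(x)-M(x)\bigr),$$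 where $\sqrt{1-2x-3x^2}$ is the formal power series with constant term $1$ whose square is $1-2x-3x^2$. Moreover, $$\ell(\mathcal{M}_n)=\binom{n;\,3}{n}-M_n+\binom{n-1;\,3}{n-1}-M_{n-1}\qquad(n\ge1),$$ $$\ell(\mathcal{M}_n)=\binom{n;\,3}{n-2}+\binom{n-1;\,3}{n-3}\qquad(n\ge3),$$ $$\ell(\mathcal{M}_n)=\frac{2}{n}\sum_{k=0}^{\lfloor n/2\rfloor}\binom{n}{k}\binom{n-k}{k}\frac{k(n-k)}{k+1}\qquad(n\ge1).$$ As $n\to+\infty$, $$\ell(\mathcal{M}_n)\sim\frac{2\cdot3^n}{\sqrt{3n\pi}}\qquad\text{and}\qquad i(\mathcal{M}_n)=\frac{\ell(\mathcal{M}_n)}{|\mathcal{M}_n|}\sim\frac49\,n .$$ In particular, the Hasse index of the Motzkin lattices is asymptotically quasi Boolean, that is, there is a constant $c$ with $0\le c\le 1/10$ such that $i(\mathcal{M}_n)\sim(1/2+c)\,n$ or $i(\mathcal{M}_n)\sim(1/2-c)\,n$. -/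

import Mathlib

open Filter Asymptotics
open scoped PowerSeries LaurentSeries

/-- The steps `U = (1,1)`, `H = (1,0)`, `D = (1,-1)`. -/
inductive MotzkinStep : Type
  | U | H | D
  deriving DecidableEq

instance : Fintype MotzkinStep where
  elems := {.U, .H, .D}
  complete := fun a => by cases a <;> simp

/-- The vertical displacement of a step. -/
def MotzkinStep.rise : MotzkinStep → ℤ
  | .U => 1
  | .H => 0
  | .D => -1

/-- The ordinate reached after the first `i` steps of a path starting at the origin. -/
def pathHeight (w : List MotzkinStep) (i : ℕ) : ℤ :=
  ((w.take i).map MotzkinStep.rise).sum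

/-- Motzkin paths of length `n`: words of `n` steps, starting at the origin, ending on the
`x`-axis and never going below the `x`-axis. -/
@[ext]
structure MotzkinPath (n : ℕ) : Type where
  steps : List MotzkinStep
  length_eq : steps.length = n
  ends_on_axis : pathHeight steps n = 0
  nonneg : ∀ i, 0 ≤ pathHeight steps i

/-- A word of steps is determined by its length and its heights. -/
theorem eq_of_pathHeight_eq : ∀ {v w : List MotzkinStep}, v.length = w.length →
    (∀ i, pathHeight v i = pathHeight w i) → v = w
  | [], [], _, _ => rfl
  | [], _ :: _, h, _ => by simp at h
  | _ :: _, [], h, _ => by simp at h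
  | a :: v, b :: w, h, hh => by
    have h1 : a.rise = b.rise := by simpa [pathHeight] using hh 1
    have hab : a = b := by
      cases a <;> cases b <;> first | rfl | (simp [MotzkinStep.rise] at h1)
    subst hab
    congr 1
    refine eq_of_pathHeight_eq (by simpa using h) fun i => ?_
    simpa [pathHeight] using hh (i + 1)

/-- `γ₁ ≤ γ₂` when `γ₁` lies weakly below `γ₂`. -/
instance (n : ℕ) : PartialOrder (MotzkinPath n) where
  le γ₁ γ₂ := ∀ i, pathHeight γ₁.steps i ≤ pathHeight γ₂.steps i
  le_refl _ _ := le_rfl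
  le_trans _ _ _ h₁ h₂ i := (h₁ i).trans (h₂ i)
  le_antisymm γ₁ γ₂ h₁ h₂ := MotzkinPath.ext <|
    eq_of_pathHeight_eq (γ₁.length_eq.trans γ₂.length_eq.symm) fun i => le_antisymm (h₁ i) (h₂ i)

instance (n : ℕ) : Finite (MotzkinPath n) :=
  Finite.of_injective (β := List.Vector MotzkinStep n) (fun γ => ⟨γ.steps, γ.length_eq⟩)
    fun _ _ h => MotzkinPath.ext (congrArg Subtype.val h)

/-- `ℓ(P)`: the number of edges of the Hasse diagram of a finite poset, that is, the number of
pairs `(x, y)` such that `y` covers `x`. -/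
noncomputable def hasseEdges (P : Type*) [PartialOrder P] : ℕ :=
  Nat.card {p : P × P // p.1 ⋖ p.2}

/-- The Hasse index `i(P) = ℓ(P) / |P|`. -/
noncomputable def hasseIndex (P : Type*) [PartialOrder P] : ℝ :=
  (hasseEdges P : ℝ) / (Nat.card P : ℝ)

/-- The edge generating series of a sequence of posets. -/
noncomputable def edgeSeries (P : ℕ → Type*) [∀ n, PartialOrder (P n)] : ℚ⟦X⟧ :=
  PowerSeries.mk fun n => (hasseEdges (P n) : ℚ)

/-- The Hasse index of a sequence of posets is asymptotically quasi Boolean when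
`i(P n) ∼ (1/2 ± c) n` for some constant `0 ≤ c ≤ 1/10`. -/
def AsymptoticallyQuasiBoolean (P : ℕ → Type*) [∀ n, PartialOrder (P n)] : Prop :=
  ∃ c : ℝ, 0 ≤ c ∧ c ≤ 1 / 10 ∧
    (((fun n => hasseIndex (P n)) ~[atTop] fun n : ℕ => (1 / 2 + c) * (n : ℝ)) ∨
      ((fun n => hasseIndex (P n)) ~[atTop] fun n : ℕ => (1 / 2 - c) * (n : ℝ)))

/-- The trinomial coefficient: the coefficient of `x ^ k` in `(1 + x + x ^ 2) ^ n`. -/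
noncomputable def trinomialCoeff (n k : ℕ) : ℕ :=
  ((1 + Polynomial.X + Polynomial.X ^ 2 : Polynomial ℕ) ^ n).coeff k

/-- The Motzkin number `M_n`, the number of Motzkin paths of length `n`. -/
noncomputable def motzkinNumber (n : ℕ) : ℕ := Nat.card (MotzkinPath n)

/-- `T(x)`, the generating series of the central trinomial coefficients. -/
noncomputable def centralTrinomialSeries : ℚ⟦X⟧ :=
  PowerSeries.mk fun n => (trinomialCoeff n n : ℚ)

/-- `M(x)`, the generating series of the Motzkin numbers. -/
noncomputable def motzkinSeries : ℚ⟦X⟧ :=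
  PowerSeries.mk fun n => (motzkinNumber n : ℚ)

/-! ### Heights and single raises -/

/-! One Motzkin path covers another exactly when it arises by raising a single interior point by one
(`MotzkinPath.covBy_iff`), so the edges are counted by summing the number of raises over all Motzkin
words.

For a recursion on the first step, the words may start at any height `h`. Their number is a
difference of two unconstrained walk counts by the reflection principle (`card_wordsFrom`). The
total number of raises satisfies a linear recurrence with ballot numbers as inhomogeneity, and
`raiseCount_succ` solves it. At `h = 0`, the relation `(n + 1) M_n = w(n + 1, 1)`, with `w` =
`walkCount`, turns the solution into `ℓ(M_{n+1}) = w(n + 1, 2) + w(n, 2)` (`hasseEdges_succ`).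

Every claim is read off from this identity. Since `w(n, 0)` is the central trinomial coefficient and
`M_n = w(n, 0) - w(n, 2)`, the coefficient formulas and `(1 + x)(T - M)` follow. The quadratic
equation of `M` gives the square root `S = 1 - x - 2x²M` and `T S = 1`, hence the closed form.
Expanding `(1 + x(1 + x))^n` gives the explicit sum. For the asymptotics, `w(n, j)` is a Fourier
coefficient of `(1 + 2 cos θ)^n`; rescaling `θ = u / √n` and dominated convergence give `w(n, j) ∼
3^n √3 / (2 √(π n))` for each fixed `j` (`tendsto_walkCount`), which settles both `ℓ(M_n)` and
`M_n`. -/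

@[simp] lemma pathHeight_zero (w : List MotzkinStep) : pathHeight w 0 = 0 := by
  simp [pathHeight]

@[simp] lemma pathHeight_nil (i : ℕ) : pathHeight [] i = 0 := by
  simp [pathHeight]

@[simp] lemma pathHeight_cons_succ (s : MotzkinStep) (w : List MotzkinStep) (i : ℕ) :
    pathHeight (s :: w) (i + 1) = s.rise + pathHeight w i := by
  simp [pathHeight]

lemma pathHeight_of_length_le {w : List MotzkinStep} {i : ℕ} (h : w.length ≤ i) :
    pathHeight w i = pathHeight w w.length := by
  simp [pathHeight, List.take_of_length_le h]

lemma MotzkinStep.rise_injective : Function.Injective MotzkinStep.rise := by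
  intro a b h
  cases a <;> cases b <;> simp_all [MotzkinStep.rise]

lemma MotzkinStep.rise_le_one (s : MotzkinStep) : s.rise ≤ 1 := by
  cases s <;> simp [MotzkinStep.rise]

lemma MotzkinStep.neg_one_le_rise (s : MotzkinStep) : -1 ≤ s.rise := by
  cases s <;> simp [MotzkinStep.rise]

lemma MotzkinStep.sum_univ {N : Type*} [AddCommMonoid N] (f : MotzkinStep → N) :
    ∑ s, f s = f .U + f .H + f .D := by
  have : (Finset.univ : Finset MotzkinStep) = {.U, .H, .D} := rfl
  rw [this, Finset.sum_insert (by simp), Finset.sum_insert (by simp), Finset.sum_singleton,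
    add_assoc]

lemma pathHeight_succ_le (w : List MotzkinStep) (i : ℕ) :
    pathHeight w (i + 1) ≤ pathHeight w i + 1 := by
  induction w generalizing i with
  | nil => simp
  | cons s w ih =>
    cases i with
    | zero => simpa using s.rise_le_one
    | succ i => have := ih i; simp only [pathHeight_cons_succ]; linarith

lemma le_pathHeight_succ (w : List MotzkinStep) (i : ℕ) :
    pathHeight w i - 1 ≤ pathHeight w (i + 1) := by
  induction w generalizing i with
  | nil => simp
  | cons s w ih =>
    cases i with
    | zero => simpa using s.neg_one_le_rise
    | succ i => have := ih i; simp only [pathHeight_cons_succ]; linarith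

/-- The words obtained by raising by one the point between the first two of the given steps, when
this is possible. -/
def raiseHead : MotzkinStep → MotzkinStep → List MotzkinStep → Finset (List MotzkinStep)
  | .D, .U, b => {.H :: .H :: b}
  | .D, .H, b => {.H :: .D :: b}
  | .H, .U, b => {.U :: .H :: b}
  | .H, .H, b => {.U :: .D :: b}
  | _, _, _ => ∅

/-- The words obtained from a word by raising exactly one of its interior points by one. -/
def raises : List MotzkinStep → Finset (List MotzkinStep)
  | s :: s' :: b => raiseHead s s' b ∪ (raises (s' :: b)).image (List.cons s)
  | _ => ∅

lemma mem_raiseHead {s s' r r' : MotzkinStep} {b c : List MotzkinStep} :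
    r :: r' :: c ∈ raiseHead s s' b ↔
      r.rise = s.rise + 1 ∧ r.rise + r'.rise = s.rise + s'.rise ∧ c = b := by
  cases s <;> cases s' <;> cases r <;> cases r' <;> simp [raiseHead, MotzkinStep.rise]

lemma exists_of_mem_raiseHead {s s' : MotzkinStep} {b w : List MotzkinStep}
    (h : w ∈ raiseHead s s' b) : ∃ r r', w = r :: r' :: b ∧ r ≠ s := by
  cases s <;> cases s' <;> simp_all [raiseHead]

/-- The union is disjoint: a raise at the first interior point changes the first step, a later one
keeps it. -/
lemma card_raises (s s' : MotzkinStep) (b : List MotzkinStep) :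
    (raises (s :: s' :: b)).card = (raiseHead s s' b).card + (raises (s' :: b)).card := by
  rw [raises, Finset.card_union_of_disjoint,
    Finset.card_image_of_injective _ (List.cons_injective)]
  rw [Finset.disjoint_left]
  intro w hw hw'
  obtain ⟨r, r', rfl, hr⟩ := exists_of_mem_raiseHead hw
  simp only [Finset.mem_image, List.cons.injEq] at hw'
  obtain ⟨a, -, h, -⟩ := hw'
  exact hr h.symm

lemma mem_raises {v w : List MotzkinStep} : w ∈ raises v ↔ v.length = w.length ∧
    ∃ i, ∀ j, pathHeight w j = pathHeight v j + if j = i then 1 else 0 := by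
  induction v generalizing w with
  | nil =>
    simp only [raises, Finset.notMem_empty, List.length_nil, false_iff, not_and, not_exists]
    intro h i hi
    rw [eq_comm, List.length_eq_zero_iff] at h
    subst h
    simpa using hi i
  | cons s v ih =>
    cases v with
    | nil =>
      simp only [raises, Finset.notMem_empty, false_iff, not_and, not_exists]
      intro h i hi
      obtain ⟨r, rfl⟩ : ∃ r, w = [r] := List.length_eq_one_iff.1 (by simpa using h.symm)
      cases i with
      | zero => simpa using hi 0
      | succ i =>
        -- Heights are constant past the end of a word, so they cannot change at one such index
        -- alone.
        have h1 := hi (i + 1)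
        have h2 := hi (i + 2)
        simp at h1 h2
        linarith
    | cons s' b =>
      constructor
      · intro h
        rw [raises, Finset.mem_union] at h
        rcases h with h | h
        · obtain ⟨r, r', rfl, -⟩ := exists_of_mem_raiseHead h
          obtain ⟨h1, h2, -⟩ := mem_raiseHead.1 h
          refine ⟨by simp, 1, fun j => ?_⟩
          match j with
          | 0 => simp
          | 1 => simpa using h1
          | j + 2 => simp; linarith
        · obtain ⟨a, ha, rfl⟩ := Finset.mem_image.1 h
          obtain ⟨hl, i, hi⟩ := ih.1 ha
          refine ⟨by simpa using hl, i + 1, fun j => ?_⟩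
          cases j with
          | zero => simp
          | succ j =>
            rw [pathHeight_cons_succ, hi, pathHeight_cons_succ]
            simp [add_assoc]
      · rintro ⟨hl, i, hi⟩
        obtain ⟨r, w, rfl⟩ := List.exists_cons_of_length_eq_add_one hl.symm
        obtain ⟨r', c, rfl⟩ := List.exists_cons_of_length_eq_add_one
          (n := b.length) (l := w) (by simpa using hl.symm)
        rw [raises, Finset.mem_union]
        match i with
        | 0 => simpa using hi 0
        | 1 =>
          left
          have h1 := hi 1
          have h2 := hi 2
          simp at h1 h2
          refine mem_raiseHead.2 ⟨h1, h2, ?_⟩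
          refine eq_of_pathHeight_eq (by simpa using hl.symm) fun j => ?_
          have h3 := hi (j + 2)
          simp at h3
          linarith
        | i + 2 =>
          right
          have h1 := hi 1
          simp at h1
          obtain rfl := MotzkinStep.rise_injective h1
          refine Finset.mem_image.2 ⟨_, ih.2 ⟨by simpa using hl, i + 1, fun j => ?_⟩, rfl⟩
          have h3 := hi (j + 1)
          rw [pathHeight_cons_succ, pathHeight_cons_succ r] at h3
          have e : (j + 1 = i + 2) ↔ (j = i + 1) := by omega
          simp only [e] at h3
          linarith

lemma exists_raise {v : List MotzkinStep} {i : ℕ} (hi : i + 1 < v.length)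
    (h₁ : pathHeight v (i + 1) ≤ pathHeight v i)
    (h₂ : pathHeight v (i + 1) ≤ pathHeight v (i + 2)) :
    ∃ w : List MotzkinStep, v.length = w.length ∧
      ∀ j, pathHeight w j = pathHeight v j + if j = i + 1 then 1 else 0 := by
  induction v generalizing i with
  | nil => simp at hi
  | cons s v ih =>
    cases v with
    | nil => simp at hi
    | cons s' b =>
      cases i with
      | zero =>
        simp at h₁ h₂
        obtain ⟨r, r', h1, h2⟩ : ∃ r r' : MotzkinStep, r.rise = s.rise + 1 ∧
            r.rise + r'.rise = s.rise + s'.rise := by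
          cases s <;> cases s' <;> simp [MotzkinStep.rise] at h₁ h₂ ⊢
          · exact ⟨.U, rfl, .H, rfl⟩
          · exact ⟨.U, rfl, .D, rfl⟩
          · exact ⟨.H, rfl, .H, rfl⟩
          · exact ⟨.H, rfl, .D, rfl⟩
        refine ⟨r :: r' :: b, by simp, fun j => ?_⟩
        match j with
        | 0 => simp
        | 1 => simpa using h1
        | j + 2 => simp; linarith
      | succ i =>
        rw [pathHeight_cons_succ s, pathHeight_cons_succ s] at h₁ h₂
        obtain ⟨w, hw, h⟩ := ih (i := i) (by simpa using hi) (by linarith) (by linarith)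
        refine ⟨s :: w, by simpa using hw, fun j => ?_⟩
        cases j with
        | zero => simp
        | succ j =>
          rw [pathHeight_cons_succ, h, pathHeight_cons_succ]
          simp [add_assoc]

/-! ### Covering pairs of Motzkin paths -/

lemma MotzkinPath.le_def {n : ℕ} {γ₁ γ₂ : MotzkinPath n} :
    γ₁ ≤ γ₂ ↔ ∀ i, pathHeight γ₁.steps i ≤ pathHeight γ₂.steps i := Iff.rfl

lemma MotzkinPath.ext_height {n : ℕ} {γ₁ γ₂ : MotzkinPath n}
    (h : ∀ i, pathHeight γ₁.steps i = pathHeight γ₂.steps i) : γ₁ = γ₂ :=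
  le_antisymm (fun i => (h i).le) (fun i => (h i).ge)

lemma MotzkinPath.height_of_le {n : ℕ} (γ : MotzkinPath n) {i : ℕ} (h : n ≤ i) :
    pathHeight γ.steps i = 0 := by
  rw [pathHeight_of_length_le (γ.length_eq.trans_le h), γ.length_eq, γ.ends_on_axis]

/-- Among the points where the two paths differ, take one where the lower path has least height. It
is a weak local minimum of the lower path: a neighbour where the paths differ is no lower by
minimality, and a neighbour where they agree is no lower because the upper path moves by at most one
per step. Raising this point keeps the path below the upper one. -/
lemma MotzkinPath.exists_raise_le {n : ℕ} {γ₁ γ₂ : MotzkinPath n} (h : γ₁ < γ₂) :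
    ∃ γ : MotzkinPath n, γ ≤ γ₂ ∧ γ.steps ∈ raises γ₁.steps := by
  obtain ⟨hle, hne⟩ := lt_iff_le_and_ne.1 h
  rw [MotzkinPath.le_def] at hle
  have hex : ∃ i, pathHeight γ₁.steps i < pathHeight γ₂.steps i := by
    by_contra! hcon
    exact hne (MotzkinPath.ext_height fun i => le_antisymm (hle i) (hcon i))
  have hlt : ∀ i, pathHeight γ₁.steps i < pathHeight γ₂.steps i → i < n := by
    intro i hi
    by_contra! hin
    rw [γ₁.height_of_le hin, γ₂.height_of_le hin] at hi
    exact lt_irrefl _ hi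
  classical
  obtain ⟨i, hi, hmin⟩ := Finset.exists_min_image
    ((Finset.range n).filter fun i => pathHeight γ₁.steps i < pathHeight γ₂.steps i)
    (pathHeight γ₁.steps)
    (by obtain ⟨i, hi⟩ := hex
        exact ⟨i, by simpa using ⟨hlt i hi, hi⟩⟩)
  simp only [Finset.mem_filter, Finset.mem_range, and_imp] at hi hmin
  obtain ⟨hin, hi⟩ := hi
  have key : ∀ j, pathHeight γ₂.steps i ≤ pathHeight γ₂.steps j + 1 →
      pathHeight γ₁.steps i ≤ pathHeight γ₁.steps j := by
    intro j hj
    rcases (hle j).lt_or_eq with h | h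
    · exact hmin j (hlt j h) h
    · linarith
  cases i with
  | zero => simp at hi
  | succ i =>
    obtain ⟨w, hw, hh⟩ := exists_raise (v := γ₁.steps) (i := i)
      (by rw [γ₁.length_eq]; exact hin) (key i (pathHeight_succ_le _ _))
      (key (i + 2) (by linarith [le_pathHeight_succ γ₂.steps (i + 1)]))
    refine ⟨⟨w, hw.symm.trans γ₁.length_eq, ?_, fun j => ?_⟩, fun j => ?_,
      mem_raises.2 ⟨hw, _, hh⟩⟩
    · rw [hh, γ₁.ends_on_axis, if_neg (by omega), add_zero]
    · rw [hh]
      have := γ₁.nonneg j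
      split_ifs <;> linarith
    · simp only [hh]
      split_ifs with hj
      · subst hj; exact hi
      · simpa using hle j

lemma MotzkinPath.covBy_iff {n : ℕ} {γ₁ γ₂ : MotzkinPath n} :
    γ₁ ⋖ γ₂ ↔ γ₂.steps ∈ raises γ₁.steps := by
  have lt_of {γ₁ γ₂ : MotzkinPath n} (h : γ₂.steps ∈ raises γ₁.steps) : γ₁ < γ₂ := by
    obtain ⟨-, i, hi⟩ := mem_raises.1 h
    refine lt_of_le_of_ne (fun j => ?_) ?_
    · rw [hi]; split_ifs <;> linarith
    · rintro rfl
      simpa using hi i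
  constructor
  · intro h
    obtain ⟨γ, hle, hγ⟩ := exists_raise_le h.lt
    rcases hle.lt_or_eq with hlt | rfl
    · exact absurd hlt (h.2 (lt_of hγ))
    · exact hγ
  · intro h
    refine ⟨lt_of h, fun γ h₁ h₂ => ?_⟩
    obtain ⟨-, i, hi⟩ := mem_raises.1 h
    have hle₁ := MotzkinPath.le_def.1 h₁.le
    have hle₂ := MotzkinPath.le_def.1 h₂.le
    have hne : ∀ j, j ≠ i → pathHeight γ₁.steps j = pathHeight γ.steps j ∧
        pathHeight γ.steps j = pathHeight γ₂.steps j := by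
      intro j hj
      have h3 := hi j
      rw [if_neg hj] at h3
      have := hle₁ j
      have := hle₂ j
      omega
    have h4 := hi i
    rw [if_pos rfl] at h4
    have h5 := hle₁ i
    have h6 := hle₂ i
    rcases (show pathHeight γ₁.steps i = pathHeight γ.steps i ∨
        pathHeight γ.steps i = pathHeight γ₂.steps i by omega) with h7 | h7
    · refine h₁.ne (ext_height fun j => ?_)
      by_cases hj : j = i
      · rw [hj, h7]
      · exact (hne j hj).1
    · refine h₂.ne (ext_height fun j => ?_)
      by_cases hj : j = i
      · rw [hj, h7]
      · exact (hne j hj).2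

/-! ### Words ending on the axis -/

/-- The words of `n` steps that, started at height `h`, end on the axis and never go below it. -/
def wordsFrom : ℕ → ℤ → Finset (List MotzkinStep)
  | 0, h => if h = 0 then {[]} else ∅
  | n + 1, h => if h < 0 then ∅ else
      Finset.univ.biUnion fun s : MotzkinStep => (wordsFrom n (h + s.rise)).image (List.cons s)

lemma sum_wordsFrom_succ {N : Type*} [AddCommMonoid N] (f : List MotzkinStep → N) (n : ℕ) {h : ℤ}
    (hh : 0 ≤ h) : ∑ w ∈ wordsFrom (n + 1) h, f w =
      ∑ w ∈ wordsFrom n (h + 1), f (.U :: w) + ∑ w ∈ wordsFrom n h, f (.H :: w)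
        + ∑ w ∈ wordsFrom n (h - 1), f (.D :: w) := by
  rw [wordsFrom, if_neg (by omega), Finset.sum_biUnion, MotzkinStep.sum_univ]
  · simp only [Finset.sum_image (List.cons_injective.injOn)]
    simp [MotzkinStep.rise, sub_eq_add_neg]
  · intro s _ s' _ hss
    simp only [Function.onFun, Finset.disjoint_left, Finset.mem_image]
    rintro _ ⟨a, _, rfl⟩ ⟨b, _, h⟩
    simp only [List.cons.injEq] at h
    exact hss h.1.symm

lemma wordsFrom_of_neg (n : ℕ) {h : ℤ} (hh : h < 0) : wordsFrom n h = ∅ := by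
  cases n with
  | zero => simp [wordsFrom, hh.ne]
  | succ n => simp [wordsFrom, hh]

lemma mem_wordsFrom {n : ℕ} {h : ℤ} {w : List MotzkinStep} : w ∈ wordsFrom n h ↔
    w.length = n ∧ h + pathHeight w n = 0 ∧ ∀ i, 0 ≤ h + pathHeight w i := by
  induction n generalizing h w with
  | zero =>
    by_cases hh : h = 0
    · subst hh
      simp only [wordsFrom, if_true, Finset.mem_singleton, List.length_eq_zero_iff]
      constructor
      · rintro rfl; simp
      · exact fun h => h.1
    · simp [wordsFrom, hh]
  | succ n ih =>
    rw [wordsFrom]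
    split_ifs with hh
    · simp only [Finset.notMem_empty, false_iff]
      rintro ⟨-, -, h0⟩
      have := h0 0
      simp at this
      omega
    · simp only [Finset.mem_biUnion, Finset.mem_univ, true_and, Finset.mem_image]
      constructor
      · rintro ⟨s, a, ha, rfl⟩
        obtain ⟨h1, h2, h3⟩ := ih.1 ha
        refine ⟨by simpa using h1, by simpa [add_assoc] using h2, fun i => ?_⟩
        cases i with
        | zero => simpa using hh
        | succ i => simpa [add_assoc] using h3 i
      · rintro ⟨h1, h2, h3⟩
        obtain ⟨s, a, rfl⟩ := List.exists_cons_of_length_eq_add_one h1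
        refine ⟨s, a, ih.2 ⟨by simpa using h1, by simpa [add_assoc] using h2, fun i => ?_⟩, rfl⟩
        simpa [add_assoc] using h3 (i + 1)

/-- Motzkin paths as words. -/
def motzkinPathEquiv (n : ℕ) : MotzkinPath n ≃ wordsFrom n 0 where
  toFun γ := ⟨γ.steps, mem_wordsFrom.2
    ⟨γ.length_eq, by simpa using γ.ends_on_axis, by simpa using γ.nonneg⟩⟩
  invFun w := ⟨w.1, (mem_wordsFrom.1 w.2).1, by simpa using (mem_wordsFrom.1 w.2).2.1,
    by simpa using (mem_wordsFrom.1 w.2).2.2⟩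
  left_inv _ := rfl
  right_inv _ := rfl

lemma motzkinNumber_eq_card (n : ℕ) : motzkinNumber n = (wordsFrom n 0).card := by
  rw [motzkinNumber, Nat.card_congr (motzkinPathEquiv n), Nat.card_eq_fintype_card,
    Fintype.card_coe]

lemma mem_wordsFrom_of_mem_raises {n : ℕ} {v w : List MotzkinStep} (hv : v ∈ wordsFrom n 0)
    (h : w ∈ raises v) : w ∈ wordsFrom n 0 := by
  obtain ⟨h1, h2, h3⟩ := mem_wordsFrom.1 hv
  obtain ⟨hl, i, hi⟩ := mem_raises.1 h
  refine mem_wordsFrom.2 ⟨hl.symm.trans h1, ?_, fun j => ?_⟩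
  · by_cases hn : n = i
    · subst hn
      -- The endpoint is never the raised point: both heights are constant from index `n` on.
      have h4 := hi n
      have h5 := hi (n + 1)
      rw [pathHeight_of_length_le (w := w) (by omega), pathHeight_of_length_le (w := v) (by omega)]
        at h4 h5
      simp at h4 h5
      omega
    · rw [hi, if_neg hn, add_zero, h2]
  · have := h3 j
    rw [hi]
    split_ifs <;> linarith

/-- Covering pairs of Motzkin paths as words together with one of their raises. -/
def coverEquiv (n : ℕ) : {p : MotzkinPath n × MotzkinPath n // p.1 ⋖ p.2} ≃
    Σ v : wordsFrom n 0, raises v.1 where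
  toFun p := ⟨motzkinPathEquiv n p.1.1, p.1.2.steps, MotzkinPath.covBy_iff.1 p.2⟩
  invFun q := ⟨((motzkinPathEquiv n).symm q.1,
    (motzkinPathEquiv n).symm ⟨q.2.1, mem_wordsFrom_of_mem_raises q.1.2 q.2.2⟩),
    MotzkinPath.covBy_iff.2 q.2.2⟩
  left_inv _ := rfl
  right_inv _ := rfl

lemma hasseEdges_eq_sum (n : ℕ) :
    hasseEdges (MotzkinPath n) = ∑ v ∈ wordsFrom n 0, (raises v).card := by
  rw [hasseEdges, Nat.card_congr (coverEquiv n), Nat.card_eq_fintype_card, Fintype.card_sigma]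
  simp only [Fintype.card_coe]
  exact Finset.sum_coe_sort (wordsFrom n 0) fun v => (raises v).card

/-! ### Unconstrained walks -/

/-- The number of walks of `n` steps `-1, 0, 1` with total displacement `j`. -/
def walkCount : ℕ → ℤ → ℤ
  | 0, j => if j = 0 then 1 else 0
  | n + 1, j => walkCount n (j - 1) + walkCount n j + walkCount n (j + 1)

lemma walkCount_neg (n : ℕ) (j : ℤ) : walkCount n (-j) = walkCount n j := by
  induction n generalizing j with
  | zero => simp [walkCount]
  | succ n ih =>
    simp only [walkCount]
    rw [← ih j, ← ih (j - 1), ← ih (j + 1)]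
    ring_nf

lemma walkCount_eq_zero {n : ℕ} {j : ℤ} (h : (n : ℤ) < -j) : walkCount n j = 0 := by
  induction n generalizing j with
  | zero => simp only [walkCount]; rw [if_neg (by omega)]
  | succ n ih =>
    push_cast at h
    rw [walkCount, ih (by omega), ih (by omega), ih (by omega)]
    rfl

/-- This compares coefficients in `x d/dx` of `(x⁻¹ + 1 + x)^(n+1)`. At `j = 1` it yields the link
between walk counts and Motzkin numbers. -/
lemma mul_walkCount_succ (n : ℕ) (j : ℤ) :
    j * walkCount (n + 1) j = (n + 1) * (walkCount n (j - 1) - walkCount n (j + 1)) := by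
  induction n generalizing j with
  | zero =>
    simp only [walkCount]
    rcases eq_or_ne j 0 with rfl | h0
    · simp
    rcases eq_or_ne j 1 with rfl | h1
    · simp
    rcases eq_or_ne j (-1) with rfl | h2
    · simp
    rw [if_neg (by omega), if_neg h0, if_neg (by omega)]
    simp
  | succ n ih =>
    have e1 := ih (j - 1)
    have e2 := ih j
    have e3 := ih (j + 1)
    have a1 : walkCount (n + 2) j =
      walkCount (n + 1) (j - 1) + walkCount (n + 1) j + walkCount (n + 1) (j + 1) := rfl
    have a2 : walkCount (n + 1) (j - 1) =
      walkCount n (j - 1 - 1) + walkCount n (j - 1) + walkCount n (j - 1 + 1) := rfl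
    have a3 : walkCount (n + 1) (j + 1) =
      walkCount n (j + 1 - 1) + walkCount n (j + 1) + walkCount n (j + 1 + 1) := rfl
    rw [sub_add_cancel] at e1 a2
    rw [add_sub_cancel_right] at e3 a3
    push_cast
    linear_combination j * a1 + e1 + e2 + e3 - (n + 1 : ℤ) * (a2 - a3)

/-- `(1 + x + x²)^n = x^n (x⁻¹ + 1 + x)^n`; the truncated indices for small `k` match walk counts
that vanish. -/
lemma trinomialCoeff_eq_walkCount (n k : ℕ) :
    (trinomialCoeff n k : ℤ) = walkCount n ((k : ℤ) - n) := by
  induction n generalizing k with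
  | zero =>
    simp [trinomialCoeff, walkCount, Polynomial.coeff_one]
  | succ n ih =>
    have hk : trinomialCoeff (n + 1) k = trinomialCoeff n k
        + (if 1 ≤ k then trinomialCoeff n (k - 1) else 0)
        + (if 2 ≤ k then trinomialCoeff n (k - 2) else 0) := by
      simp only [trinomialCoeff]
      rw [pow_succ, mul_add, mul_add, mul_one, Polynomial.coeff_add, Polynomial.coeff_add,
        Polynomial.coeff_mul_X_pow']
      congr 2
      have := Polynomial.coeff_mul_X_pow'
        ((1 + Polynomial.X + Polynomial.X ^ 2 : Polynomial ℕ) ^ n) 1 k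
      rwa [pow_one] at this
    have h1 : ((if 1 ≤ k then trinomialCoeff n (k - 1) else 0 : ℕ) : ℤ)
        = walkCount n ((k : ℤ) - (n + 1)) := by
      split_ifs with h
      · rw [ih]; congr 1; omega
      · rw [walkCount_eq_zero (by omega)]; rfl
    have h2 : ((if 2 ≤ k then trinomialCoeff n (k - 2) else 0 : ℕ) : ℤ)
        = walkCount n ((k : ℤ) - (n + 2)) := by
      split_ifs with h
      · rw [ih]; congr 1; omega
      · rw [walkCount_eq_zero (by omega)]; rfl
    rw [hk]
    push_cast [walkCount] at h1 h2 ⊢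
    rw [h1, h2, ih]
    ring_nf

/-! ### Ballot numbers -/

/-- The ballot-type difference counting, for `h ≥ -1`, the words of `n` steps from height `h` to
the axis that stay nonnegative. -/
def ballot (n : ℕ) (h : ℤ) : ℤ := walkCount n h - walkCount n (h + 2)

lemma ballot_succ (n : ℕ) (h : ℤ) :
    ballot (n + 1) h = ballot n (h - 1) + ballot n h + ballot n (h + 1) := by
  simp only [ballot, walkCount]
  ring_nf

lemma ballot_neg_one (n : ℕ) : ballot n (-1) = 0 := by
  rw [ballot, walkCount_neg]; norm_num

lemma ballot_zero_left {h : ℤ} (hh : -1 ≤ h) : ballot 0 h = if h = 0 then 1 else 0 := by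
  simp only [ballot, walkCount]
  rw [if_neg (show ¬ (h + 2 = 0) by omega), sub_zero]

/-- Both sides obey the same recurrence, and both vanish at the absorbing height `-1`, the right one
by the symmetry of walks. Admitting `h = -1` lets the induction reach `h = 0`. -/
lemma card_wordsFrom (n : ℕ) {h : ℤ} (hh : -1 ≤ h) :
    ((wordsFrom n h).card : ℤ) = ballot n h := by
  induction n generalizing h with
  | zero =>
    rw [ballot_zero_left hh, wordsFrom]
    split_ifs <;> simp
  | succ n ih =>
    rcases hh.eq_or_lt with rfl | hlt
    · rw [wordsFrom_of_neg _ (by norm_num), ballot_neg_one]; rfl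
    · rw [Finset.card_eq_sum_ones, sum_wordsFrom_succ _ _ (by omega)]
      simp only [← Finset.card_eq_sum_ones]
      push_cast
      rw [ih (by omega), ih (by omega), ih (by omega), ballot_succ]
      ring

lemma motzkinNumber_eq_ballot (n : ℕ) : (motzkinNumber n : ℤ) = ballot n 0 := by
  rw [motzkinNumber_eq_card, card_wordsFrom _ (by norm_num)]

/-- The total number of raises of the words of `n` steps from height `h`. -/
def raiseCount (n : ℕ) (h : ℤ) : ℤ := ∑ v ∈ wordsFrom n h, ((raises v).card : ℤ)

lemma raiseCount_of_neg (n : ℕ) {h : ℤ} (hh : h < 0) : raiseCount n h = 0 := by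
  simp [raiseCount, wordsFrom_of_neg n hh]

lemma raiseCount_one (h : ℤ) : raiseCount 1 h = 0 := by
  refine Finset.sum_eq_zero fun v hv => ?_
  obtain ⟨s, rfl⟩ := List.length_eq_one_iff.1 (mem_wordsFrom.1 hv).1
  simp [raises]

lemma sum_raises_cons (s : MotzkinStep) (n : ℕ) (h : ℤ) :
    ∑ w ∈ wordsFrom (n + 1) h, ((raises (s :: w)).card : ℤ) =
      (if 0 ≤ h then
        ∑ w ∈ wordsFrom n (h + 1), ((raiseHead s .U w).card : ℤ)
          + ∑ w ∈ wordsFrom n h, ((raiseHead s .H w).card : ℤ)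
          + ∑ w ∈ wordsFrom n (h - 1), ((raiseHead s .D w).card : ℤ) else 0)
      + raiseCount (n + 1) h := by
  split_ifs with hh
  · rw [raiseCount, sum_wordsFrom_succ _ _ hh, sum_wordsFrom_succ _ _ hh]
    simp only [card_raises]
    push_cast
    simp only [Finset.sum_add_distrib]
    ring
  · rw [raiseCount, wordsFrom_of_neg _ (by omega)]; simp

/-- The ballot terms count raises at the first interior point: `HU` and `HH`, then `DU` and `DH`,
the latter two available only when `h` is positive. -/
lemma raiseCount_succ_succ (n : ℕ) {h : ℤ} (hh : 0 ≤ h) :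
    raiseCount (n + 2) h =
      raiseCount (n + 1) (h + 1) + raiseCount (n + 1) h + raiseCount (n + 1) (h - 1)
        + (ballot n (h + 1) + ballot n h)
        + (if h = 0 then 0 else ballot n h + ballot n (h - 1)) := by
  rw [raiseCount, sum_wordsFrom_succ _ _ hh, sum_raises_cons, sum_raises_cons, sum_raises_cons,
    if_pos (by omega), if_pos hh]
  simp only [raiseHead, Finset.card_empty, Finset.card_singleton, Nat.cast_zero, Nat.cast_one,
    Finset.sum_const_zero, Finset.sum_const, nsmul_eq_mul, mul_one]
  rw [card_wordsFrom n (h := h) (by omega), card_wordsFrom n (h := h + 1) (by omega)]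
  split_ifs with h1 h2 h2
  · omega
  · rw [sub_add_cancel, card_wordsFrom n (h := h) (by omega),
      card_wordsFrom n (h := h - 1) (by omega)]
    ring
  · ring
  · omega

/-- Heuristically, each of the `n` interior points is the middle of a raisable pair `HU`, `HH`, `DU`
or `DH`, of rise `1`, `0`, `0`, `-1`, and `n - 1` other steps remain; this gives the weights `1, 2,
1`. The subtracted ballot number corrects for the axis. The formula fails at `h = -1`, so the case
`h = 0` of the induction is separate. -/
lemma raiseCount_succ (n : ℕ) {h : ℤ} (hh : 0 ≤ h) :
    raiseCount (n + 1) h =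
      n * (ballot (n - 1) (h + 1) + 2 * ballot (n - 1) h + ballot (n - 1) (h - 1))
        - ballot n (h + 1) := by
  induction n generalizing h with
  | zero =>
    rw [raiseCount_one, ballot_zero_left (by omega), if_neg (by omega)]; simp
  | succ n ih =>
    -- The factor `n` makes the ballot recurrence valid at `n = 0` too, despite the truncated `n -
    -- 1`.
    have key : ∀ j : ℤ, (n : ℤ) * ballot n j = n * (ballot (n - 1) (j - 1) + ballot (n - 1) j
        + ballot (n - 1) (j + 1)) := by
      intro j
      cases n with
      | zero => simp
      | succ n => rw [ballot_succ]; simp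
    have k1 := key (h + 1)
    have k2 := key h
    have k3 := key (h - 1)
    have b1 := ballot_succ n (h + 1)
    rw [raiseCount_succ_succ _ hh, ih hh, ih (show 0 ≤ h + 1 by omega)]
    simp only [add_tsub_cancel_right, sub_add_cancel] at *
    push_cast
    split_ifs with h0
    · subst h0
      rw [raiseCount_of_neg _ (by norm_num)]
      have z1 := ballot_neg_one n
      have z2 := ballot_neg_one (n - 1)
      simp only [zero_sub, zero_add, z1, z2] at k1 k2 b1 ⊢
      linear_combination (-1 : ℤ) * k1 - 2 * k2 + b1
    · rw [ih (show 0 ≤ h - 1 by omega)]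
      simp only [sub_add_cancel]
      linear_combination (-1 : ℤ) * k1 - 2 * k2 - k3 + b1

/-! ### Closed forms for the number of edges -/

lemma succ_mul_ballot_zero (n : ℕ) : ((n : ℤ) + 1) * ballot n 0 = walkCount (n + 1) 1 := by
  have := mul_walkCount_succ n 1
  norm_num at this
  rw [this, ballot]
  norm_num

lemma walkCount_succ_zero (n : ℕ) :
    walkCount (n + 1) 0 = walkCount n 0 + 2 * walkCount n 1 := by
  have := walkCount_neg n 1
  simp only [walkCount, zero_sub, zero_add, this]
  ring

lemma walkCount_succ_one (n : ℕ) :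
    walkCount (n + 1) 1 = walkCount n 0 + walkCount n 1 + walkCount n 2 := by
  simp [walkCount]

lemma hasseEdges_succ (n : ℕ) : (hasseEdges (MotzkinPath (n + 1)) : ℤ) =
    walkCount (n + 1) 2 + walkCount n 2 := by
  have h : (hasseEdges (MotzkinPath (n + 1)) : ℤ) = raiseCount (n + 1) 0 := by
    rw [hasseEdges_eq_sum, raiseCount]; push_cast; rfl
  rw [h, raiseCount_succ n le_rfl]
  cases n with
  | zero => simp [ballot, walkCount]
  | succ n =>
    have e1 := succ_mul_ballot_zero n
    have e2 := succ_mul_ballot_zero (n + 1)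
    have b1 := ballot_succ n 0
    have b2 := ballot_succ (n + 1) 0
    have w1 := walkCount_succ_zero (n + 1)
    have w2 := walkCount_succ_one (n + 1)
    have d1 : ballot (n + 1) 0 = walkCount (n + 1) 0 - walkCount (n + 1) 2 := by simp [ballot]
    have d2 : ballot (n + 2) 0 = walkCount (n + 2) 0 - walkCount (n + 2) 2 := by simp [ballot]
    have z1 := ballot_neg_one n
    have z2 := ballot_neg_one (n + 1)
    simp only [zero_add, zero_sub, z1, z2, add_tsub_cancel_right] at *
    push_cast at *
    -- The ballot recurrence collapses the closed form to `w(n + 2, 1) + w(n + 1, 1) - ballot (n +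
    -- 2) 0`; the walk recurrences do the rest.
    linear_combination e1 + e2 - (n + 1 : ℤ) * b1 + b2 - w1 + w2 - d2

lemma hasseEdges_zero : hasseEdges (MotzkinPath 0) = 0 := by
  simp [hasseEdges_eq_sum, wordsFrom, raises]

lemma trinomialCoeff_self (n : ℕ) : (trinomialCoeff n n : ℤ) = walkCount n 0 := by
  simp [trinomialCoeff_eq_walkCount]

lemma trinomialCoeff_sub_motzkinNumber (n : ℕ) :
    (trinomialCoeff n n : ℤ) - motzkinNumber n = walkCount n 2 := by
  rw [trinomialCoeff_self, motzkinNumber_eq_ballot, ballot]; simp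

theorem hasseEdges_eq_central {n : ℕ} (hn : 1 ≤ n) : (hasseEdges (MotzkinPath n) : ℤ) =
    (trinomialCoeff n n : ℤ) - (motzkinNumber n : ℤ)
      + (trinomialCoeff (n - 1) (n - 1) : ℤ) - (motzkinNumber (n - 1) : ℤ) := by
  obtain ⟨n, rfl⟩ := Nat.exists_eq_add_of_le' hn
  rw [hasseEdges_succ, ← trinomialCoeff_sub_motzkinNumber, ← trinomialCoeff_sub_motzkinNumber]
  simp only [add_tsub_cancel_right]
  ring

lemma trinomialCoeff_sub_two {n : ℕ} (hn : 2 ≤ n) :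
    (trinomialCoeff n (n - 2) : ℤ) = walkCount n 2 := by
  rw [trinomialCoeff_eq_walkCount, ← walkCount_neg n 2]
  congr 1
  omega

theorem hasseEdges_eq_trinomialCoeff {n : ℕ} (hn : 3 ≤ n) : hasseEdges (MotzkinPath n) =
    trinomialCoeff n (n - 2) + trinomialCoeff (n - 1) (n - 3) := by
  have h1 := trinomialCoeff_sub_two (n := n) (by omega)
  have h2 := trinomialCoeff_sub_two (n := n - 1) (by omega)
  have h3 := hasseEdges_succ (n - 1)
  rw [show n - 1 - 2 = n - 3 by omega] at h2
  rw [show n - 1 + 1 = n by omega] at h3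
  zify
  rw [h1, h2, h3]

/-! ### Generating series -/

/-- Combinatorially, a word from height `h + 1` is cut at the step by which it first reaches the
axis. The case `h = 0` yields the Motzkin convolution. -/
lemma sum_ballot_mul_ballot (n : ℕ) {h : ℤ} (hh : 0 ≤ h) :
    ∑ p ∈ Finset.HasAntidiagonal.antidiagonal n, ballot p.1 h * ballot p.2 0 =
      ballot (n + 1) (h + 1) := by
  induction n generalizing h with
  | zero =>
    have h2 : ballot 0 (h + 1 + 1) = 0 := by
      rw [ballot_zero_left (by omega), if_neg (by omega)]
    have h1 : ballot 0 (h + 1) = 0 := by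
      rw [ballot_zero_left (by omega), if_neg (by omega)]
    rw [ballot_succ, h1, h2]
    simp [ballot_zero_left]
  | succ n ih =>
    rw [Finset.Nat.sum_antidiagonal_succ]
    simp only [ballot_succ _ h, add_mul, Finset.sum_add_distrib]
    rw [ih hh, ih (show 0 ≤ h + 1 by omega), ballot_zero_left (by omega),
      ballot_succ (n + 1) (h + 1), add_sub_cancel_right]
    split_ifs with h0
    · subst h0
      simp only [zero_sub, ballot_neg_one]
      simp
      ring
    · rw [ih (show 0 ≤ h - 1 by omega), sub_add_cancel]
      ring

lemma motzkinNumber_add_two (n : ℕ) : (motzkinNumber (n + 2) : ℤ) = motzkinNumber (n + 1) +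
    ∑ p ∈ Finset.HasAntidiagonal.antidiagonal n, (motzkinNumber p.1 : ℤ) * motzkinNumber p.2 := by
  simp only [motzkinNumber_eq_ballot]
  rw [sum_ballot_mul_ballot n le_rfl, ballot_succ (n + 1), zero_sub, ballot_neg_one]
  ring

lemma motzkinNumber_zero : motzkinNumber 0 = 1 := by
  simp [motzkinNumber_eq_card, wordsFrom]

lemma motzkinNumber_one : motzkinNumber 1 = 1 := by
  zify
  rw [motzkinNumber_eq_ballot]
  simp [ballot, walkCount]

lemma motzkinSeries_eq : motzkinSeries =
    1 + PowerSeries.X * motzkinSeries + PowerSeries.X ^ 2 * motzkinSeries ^ 2 := by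
  ext n
  match n with
  | 0 => simp [motzkinSeries, motzkinNumber_zero]
  | 1 =>
    rw [pow_two PowerSeries.X, mul_assoc, map_add, map_add, PowerSeries.coeff_succ_X_mul,
      PowerSeries.coeff_succ_X_mul]
    simp [motzkinSeries, motzkinNumber_zero, motzkinNumber_one, PowerSeries.coeff_one]
  | n + 2 =>
    rw [pow_two PowerSeries.X, mul_assoc, map_add, map_add, PowerSeries.coeff_succ_X_mul,
      PowerSeries.coeff_succ_X_mul, PowerSeries.coeff_succ_X_mul, pow_two, PowerSeries.coeff_mul]
    have := motzkinNumber_add_two n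
    simp only [motzkinSeries, PowerSeries.coeff_mk, PowerSeries.coeff_one]
    simp only [Nat.add_eq_zero_iff, OfNat.ofNat_ne_zero, and_false, if_false, zero_add]
    exact_mod_cast this

/-- The formal power series `√(1 - 2x - 3x²)` with constant term `1`. -/
noncomputable def sqrtSeries : ℚ⟦X⟧ :=
  1 - PowerSeries.X - 2 * PowerSeries.X ^ 2 * motzkinSeries

lemma constantCoeff_sqrtSeries : PowerSeries.constantCoeff sqrtSeries = 1 := by
  simp [sqrtSeries]

/-- Completing the square in `x²M² - (1 - x)M + 1 = 0`, whose discriminant is `(1 - x)² - 4x²`. -/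
lemma sqrtSeries_sq :
    sqrtSeries ^ 2 = 1 - 2 * PowerSeries.X - 3 * PowerSeries.X ^ 2 := by
  have := motzkinSeries_eq
  rw [sqrtSeries]
  linear_combination (-4 * PowerSeries.X ^ 2 : ℚ⟦X⟧) * this

lemma trinomialCoeff_add_two (n : ℕ) :
    (trinomialCoeff (n + 2) (n + 2) : ℤ) - 2 * trinomialCoeff (n + 1) (n + 1)
      - 3 * trinomialCoeff n n = - 2 * motzkinNumber n := by
  have h := trinomialCoeff_sub_motzkinNumber n
  have h1 := walkCount_succ_zero n
  have h2 := walkCount_succ_zero (n + 1)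
  have h3 := walkCount_succ_one n
  simp only [trinomialCoeff_self] at *
  linear_combination h2 - h1 + 2 * h3 - 2 * h

lemma centralTrinomialSeries_mul : centralTrinomialSeries *
    (1 - 2 * PowerSeries.X - 3 * PowerSeries.X ^ 2) = sqrtSeries := by
  -- Horner form, so that coefficients can be read off by stripping one factor `X` at a time.
  have e : centralTrinomialSeries * (1 - 2 * PowerSeries.X - 3 * PowerSeries.X ^ 2)
      = centralTrinomialSeries - PowerSeries.X * (PowerSeries.C 2 * centralTrinomialSeries
        + PowerSeries.X * (PowerSeries.C 3 * centralTrinomialSeries)) := by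
    rw [show (PowerSeries.C 2 : ℚ⟦X⟧) = 2 from rfl, show (PowerSeries.C 3 : ℚ⟦X⟧) = 3 from rfl]
    ring
  have e' : sqrtSeries = 1 - PowerSeries.X * (1 + PowerSeries.X *
      (PowerSeries.C 2 * motzkinSeries)) := by
    rw [sqrtSeries, show (PowerSeries.C 2 : ℚ⟦X⟧) = 2 from rfl]
    ring
  have t0 : (trinomialCoeff 0 0 : ℚ) = 1 := by
    have := trinomialCoeff_self 0
    rw [walkCount] at this
    exact_mod_cast this
  have t1 : (trinomialCoeff 1 1 : ℚ) = 1 := by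
    have := trinomialCoeff_self 1
    simp only [walkCount] at this
    exact_mod_cast this
  rw [e, e']
  ext n
  match n with
  | 0 => simp [centralTrinomialSeries, t0]
  | 1 =>
    rw [map_sub, map_sub, PowerSeries.coeff_succ_X_mul, PowerSeries.coeff_succ_X_mul]
    simp [centralTrinomialSeries, t0, t1, PowerSeries.coeff_one]
    norm_num
  | n + 2 =>
    rw [map_sub, map_sub, PowerSeries.coeff_succ_X_mul, PowerSeries.coeff_succ_X_mul, map_add,
      map_add, PowerSeries.coeff_succ_X_mul, PowerSeries.coeff_succ_X_mul]
    simp only [PowerSeries.coeff_C_mul, centralTrinomialSeries, motzkinSeries,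
      PowerSeries.coeff_mk, PowerSeries.coeff_one]
    have := trinomialCoeff_add_two n
    have h : (trinomialCoeff (n + 2) (n + 2) : ℚ) - 2 * trinomialCoeff (n + 1) (n + 1)
      - 3 * trinomialCoeff n n = - 2 * motzkinNumber n := by exact_mod_cast this
    simp only [Nat.add_eq_zero_iff, OfNat.ofNat_ne_zero, one_ne_zero, and_false, if_false]
    linear_combination h

lemma sqrtSeries_ne_zero : sqrtSeries ≠ 0 := by
  intro h
  have := constantCoeff_sqrtSeries
  rw [h] at this
  simp at this

lemma centralTrinomialSeries_mul_sqrtSeries : centralTrinomialSeries * sqrtSeries = 1 := by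
  have h := centralTrinomialSeries_mul
  rw [← sqrtSeries_sq] at h
  refine mul_right_cancel₀ sqrtSeries_ne_zero ?_
  linear_combination h

theorem edgeSeries_eq : edgeSeries MotzkinPath =
    (1 + PowerSeries.X) * (centralTrinomialSeries - motzkinSeries) := by
  have h (n : ℕ) : (trinomialCoeff n n : ℚ) - motzkinNumber n = walkCount n 2 := by
    exact_mod_cast trinomialCoeff_sub_motzkinNumber n
  rw [add_mul, one_mul]
  ext n
  cases n with
  | zero => simp [edgeSeries, hasseEdges_zero, centralTrinomialSeries, motzkinSeries, h, walkCount]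
  | succ n =>
    rw [map_add, PowerSeries.coeff_succ_X_mul]
    simp only [map_sub, edgeSeries, centralTrinomialSeries, motzkinSeries, PowerSeries.coeff_mk, h]
    exact_mod_cast hasseEdges_succ n

theorem edgeSeries_eq_div : (edgeSeries MotzkinPath : ℚ⸨X⸩) =
    (((1 + PowerSeries.X) * (1 - 2 * PowerSeries.X - PowerSeries.X ^ 2
        - (1 - PowerSeries.X) * sqrtSeries) : ℚ⟦X⟧) : ℚ⸨X⸩) /
      ((2 * PowerSeries.X ^ 2 * sqrtSeries : ℚ⟦X⟧) : ℚ⸨X⸩) := by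
  have h2ne : (2 : ℚ⟦X⟧) ≠ 0 := by
    intro h
    have := congrArg PowerSeries.constantCoeff h
    rw [map_ofNat, map_zero] at this
    norm_num at this
  have hne : (2 * PowerSeries.X ^ 2 * sqrtSeries : ℚ⟦X⟧) ≠ 0 :=
    mul_ne_zero (mul_ne_zero h2ne (pow_ne_zero 2 PowerSeries.X_ne_zero)) sqrtSeries_ne_zero
  rw [eq_div_iff (by
    intro h
    exact hne (HahnSeries.ofPowerSeries_injective (h.trans (map_zero _).symm))), ← map_mul]
  congr 1
  rw [edgeSeries_eq]
  have h1 := centralTrinomialSeries_mul_sqrtSeries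
  have h2 := sqrtSeries_sq
  have h3 : sqrtSeries = 1 - PowerSeries.X - 2 * PowerSeries.X ^ 2 * motzkinSeries := rfl
  -- From `T S = 1` and `2x²M = 1 - x - S` one gets `2x² S (T - M) = 2x² - (1 - x) S + S²`.
  linear_combination (1 + PowerSeries.X : ℚ⟦X⟧) * (2 * PowerSeries.X ^ 2 * h1 + h2
    - sqrtSeries * h3)

/-! ### The explicit sum -/

/-- Here `k` is the number of down steps, so that `k + 2` of the others are up steps. -/
lemma walkCount_two_eq_sum (n : ℕ) :
    walkCount n 2 = ∑ k ∈ Finset.range (n + 1), (n.choose k * (n - k).choose (k + 2) : ℤ) := by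
  have h := trinomialCoeff_eq_walkCount n (n + 2)
  rw [show ((n + 2 : ℕ) : ℤ) - n = 2 by push_cast; ring] at h
  rw [← h, trinomialCoeff, show (1 + Polynomial.X + Polynomial.X ^ 2 : Polynomial ℕ)
    = 1 + (1 + Polynomial.X) * Polynomial.X by ring, add_pow, Polynomial.finsetSum_coeff]
  push_cast
  refine Finset.sum_congr rfl fun k hk => ?_
  have hk := Finset.mem_range_succ_iff.1 hk
  rw [one_pow, one_mul, mul_pow, Polynomial.coeff_mul_natCast, Polynomial.coeff_mul_X_pow',
    if_pos (by omega), Polynomial.coeff_one_add_X_pow, show n + 2 - (n - k) = k + 2 by omega]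
  push_cast
  ring

/-- Term `k` of the two walk counts matches term `k + 1` of the explicit sum, whose term `0`
vanishes. With `m = k + d`, all binomials reduce to `(k + d).choose k` and `d.choose (k + 1)`. -/
lemma choose_mul_choose_add_eq {m k : ℕ} (hk : k ≤ m) :
    ((m + 1).choose k * (m + 1 - k).choose (k + 2) : ℚ) + m.choose k * (m - k).choose (k + 2) =
      2 / ((m + 1 : ℕ) : ℚ) * ((m + 1).choose (k + 1) * (m + 1 - (k + 1)).choose (k + 1) *
        ((((k + 1 : ℕ) : ℚ) * (((m + 1 : ℕ) : ℚ) - ((k + 1 : ℕ) : ℚ)))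
          / (((k + 1 : ℕ) : ℚ) + 1))) := by
  obtain ⟨d, rfl⟩ := Nat.exists_eq_add_of_le hk
  rw [show k + d + 1 - k = d + 1 by omega, show k + d - k = d by omega,
    show k + d + 1 - (k + 1) = d by omega]
  have h1 : ((k + d + 1).choose (k + 1) * (k + 1) : ℚ) = (k + d + 1) * (k + d).choose k := by
    exact_mod_cast (Nat.add_one_mul_choose_eq (k + d) k).symm
  have h2 : ((d + 1).choose (k + 2) * (k + 2) : ℚ) = (d + 1) * d.choose (k + 1) := by
    exact_mod_cast (Nat.add_one_mul_choose_eq d (k + 1)).symm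
  have h3 : (d.choose (k + 2) * (k + 2) : ℚ) = d.choose (k + 1) * (d - (k + 1)) := by
    have := Nat.choose_succ_right_eq d (k + 1)
    rcases le_or_gt (k + 1) d with h | h
    · rw [← Nat.cast_add_one, ← Nat.cast_sub h]
      exact_mod_cast this
    · rw [Nat.choose_eq_zero_of_lt h, Nat.choose_eq_zero_of_lt (by omega)]
      simp
  have h4 : ((k + d + 1).choose k * (d + 1) : ℚ) = (k + d).choose k * (k + d + 1) := by
    have := Nat.choose_mul_succ_eq (k + d) k
    rw [show k + d + 1 - k = d + 1 by omega] at this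
    exact_mod_cast this.symm
  have hd : (d + 1 : ℚ) ≠ 0 := by positivity
  have hk2 : (k + 2 : ℚ) ≠ 0 := by positivity
  have hN : (k + d + 1 : ℚ) ≠ 0 := by positivity
  have hk1 : (k + 1 : ℚ) ≠ 0 := by positivity
  have e1 : ((k + d + 1).choose (k + 1) : ℚ) = (k + d + 1) * (k + d).choose k / (k + 1) := by
    rw [← h1]; field_simp
  have e2 : ((d + 1).choose (k + 2) : ℚ) = (d + 1) * d.choose (k + 1) / (k + 2) := by
    rw [← h2]; field_simp
  have e3 : (d.choose (k + 2) : ℚ) = d.choose (k + 1) * (d - (k + 1)) / (k + 2) := by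
    rw [← h3]; field_simp
  have e4 : ((k + d + 1).choose k : ℚ) = (k + d).choose k * (k + d + 1) / (d + 1) := by
    rw [← h4]; field_simp
  rw [e1, e2, e3, e4]
  push_cast
  rw [show (k + 1 + 1 : ℚ) = k + 2 by ring]
  field_simp
  ring

theorem hasseEdges_eq_sum_choose {n : ℕ} (hn : 1 ≤ n) : (hasseEdges (MotzkinPath n) : ℚ) =
    (2 / (n : ℚ)) * ∑ k ∈ Finset.range (n / 2 + 1),
      (n.choose k : ℚ) * ((n - k).choose k : ℚ)
        * (((k : ℚ) * ((n : ℚ) - (k : ℚ))) / ((k : ℚ) + 1)) := by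
  obtain ⟨m, rfl⟩ := Nat.exists_eq_add_of_le' hn
  have hl : (hasseEdges (MotzkinPath (m + 1)) : ℚ) = walkCount (m + 1) 2 + walkCount m 2 := by
    exact_mod_cast hasseEdges_succ m
  rw [hl, walkCount_two_eq_sum, walkCount_two_eq_sum, Finset.sum_range_succ _ (m + 1)]
  rw [Finset.sum_subset (s₁ := Finset.range ((m + 1) / 2 + 1)) (s₂ := Finset.range (m + 2))
    (fun k hk => by simp at hk ⊢; omega)
    (fun k _ hk => by
      rw [Nat.choose_eq_zero_of_lt (n := m + 1 - k) (k := k) (by simp at hk; omega)]; simp),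
    Finset.sum_range_succ' _ (m + 1)]
  push_cast
  simp only [tsub_self, Nat.choose_zero_succ, Nat.cast_zero, mul_zero, add_zero, zero_mul,
    zero_div]
  rw [← Finset.sum_add_distrib, Finset.mul_sum]
  refine Finset.sum_congr rfl fun k hk => ?_
  have := choose_mul_choose_add_eq (Finset.mem_range_succ_iff.1 hk)
  push_cast at this
  exact this

/-! ### Asymptotics -/

lemma integral_cos_int_mul (j : ℤ) :
    ∫ θ in (-Real.pi)..Real.pi, Real.cos (j * θ) = if j = 0 then 2 * Real.pi else 0 := by
  split_ifs with h
  · subst h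
    simp
    ring
  · have hj : (j : ℝ) ≠ 0 := by exact_mod_cast h
    rw [intervalIntegral.integral_comp_mul_left _ hj, integral_cos, mul_neg, Real.sin_neg,
      Real.sin_int_mul_pi]
    simp

lemma integral_walkCount (n : ℕ) (j : ℤ) :
    ∫ θ in (-Real.pi)..Real.pi, (1 + 2 * Real.cos θ) ^ n * Real.cos (j * θ) =
      2 * Real.pi * walkCount n j := by
  induction n generalizing j with
  | zero =>
    simp only [pow_zero, one_mul, integral_cos_int_mul, walkCount]
    split_ifs <;> simp
  | succ n ih =>
    have hint (j : ℤ) : IntervalIntegrable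
        (fun θ : ℝ => (1 + 2 * Real.cos θ) ^ n * Real.cos (j * θ)) MeasureTheory.volume
        (-Real.pi) Real.pi :=
      Continuous.intervalIntegrable (by fun_prop) _ _
    have e (θ : ℝ) : (1 + 2 * Real.cos θ) ^ (n + 1) * Real.cos (j * θ) =
        (1 + 2 * Real.cos θ) ^ n * Real.cos ((j - 1 : ℤ) * θ)
        + (1 + 2 * Real.cos θ) ^ n * Real.cos (j * θ)
        + (1 + 2 * Real.cos θ) ^ n * Real.cos ((j + 1 : ℤ) * θ) := by
      push_cast
      rw [sub_mul, add_mul, one_mul, Real.cos_sub, Real.cos_add]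
      ring
    simp only [e]
    rw [intervalIntegral.integral_add ((hint _).add (hint _)) (hint _),
      intervalIntegral.integral_add (hint _) (hint _), ih, ih, ih, walkCount]
    push_cast
    ring

/-- The rescaled integrand of the Fourier integral for `walkCount`. -/
noncomputable def walkKernel (j : ℤ) (n : ℕ) (u : ℝ) : ℝ :=
  (Set.Ioc (-Real.pi) Real.pi).indicator
    (fun θ => ((1 + 2 * Real.cos θ) / 3) ^ n * Real.cos (j * θ)) (u / √n)

lemma integral_walkKernel (j : ℤ) (n : ℕ) :
    ∫ u, walkKernel j n u = 2 * Real.pi * (walkCount n j * √n / 3 ^ n) := by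
  simp only [walkKernel]
  rw [MeasureTheory.Measure.integral_comp_div
    (Set.indicator (Set.Ioc (-Real.pi) Real.pi) _) (√n),
    MeasureTheory.integral_indicator measurableSet_Ioc,
    ← intervalIntegral.integral_of_le (by linarith [Real.pi_pos])]
  have e (θ : ℝ) : ((1 + 2 * Real.cos θ) / 3) ^ n * Real.cos (j * θ) =
      (3 ^ n)⁻¹ * ((1 + 2 * Real.cos θ) ^ n * Real.cos (j * θ)) := by
    rw [div_pow]; ring
  simp only [e]
  rw [intervalIntegral.integral_const_mul, integral_walkCount,
    abs_of_nonneg (Real.sqrt_nonneg _), smul_eq_mul]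
  ring

/-- With `t = θ² / π² ≤ 1`, the exponential is at least `1 - 2t/3 ≥ 1/3`. This dominates the upper
bound `1 - 4t/3` and the absolute value `1/3` of the least value `-1/3`, which is what fixes the
constant. -/
lemma abs_one_add_two_cos_div_three_le {θ : ℝ} (h : |θ| ≤ Real.pi) :
    |(1 + 2 * Real.cos θ) / 3| ≤ Real.exp (-(2 / (3 * Real.pi ^ 2)) * θ ^ 2) := by
  have hpi := Real.pi_pos
  have hsq : θ ^ 2 / Real.pi ^ 2 ≤ 1 := by
    rw [div_le_one (by positivity)]
    exact sq_le_sq.2 (by rwa [abs_of_pos hpi])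
  have hnn : 0 ≤ θ ^ 2 / Real.pi ^ 2 := by positivity
  have hcos := Real.cos_le_one_sub_mul_cos_sq h
  rw [show 2 / Real.pi ^ 2 * θ ^ 2 = 2 * (θ ^ 2 / Real.pi ^ 2) by ring] at hcos
  have hcos' := Real.neg_one_le_cos θ
  have hexp := Real.add_one_le_exp (-(2 / (3 * Real.pi ^ 2)) * θ ^ 2)
  rw [show -(2 / (3 * Real.pi ^ 2)) * θ ^ 2 = -(2 / 3) * (θ ^ 2 / Real.pi ^ 2) by
    field_simp] at hexp ⊢
  rw [abs_le]
  constructor <;> linarith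

lemma norm_walkKernel_le (j : ℤ) {n : ℕ} (hn : 1 ≤ n) (u : ℝ) :
    ‖walkKernel j n u‖ ≤ Real.exp (-(2 / (3 * Real.pi ^ 2)) * u ^ 2) := by
  rw [walkKernel]
  by_cases h : u / √n ∈ Set.Ioc (-Real.pi) Real.pi
  · rw [Set.indicator_of_mem h, Real.norm_eq_abs, abs_mul, abs_pow]
    have hn0 : (0 : ℝ) < n := by exact_mod_cast hn
    calc _ ≤ Real.exp (-(2 / (3 * Real.pi ^ 2)) * (u / √n) ^ 2) ^ n * 1 := by
          gcongr
          · exact abs_one_add_two_cos_div_three_le (abs_le.2 ⟨h.1.le, h.2⟩)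
          · exact Real.abs_cos_le_one _
      _ = _ := by
          rw [mul_one, ← Real.exp_nat_mul, div_pow, Real.sq_sqrt hn0.le]
          congr 1
          field_simp
  · rw [Set.indicator_of_notMem h, norm_zero]
    positivity

lemma tendsto_div_sqrt_natCast (u : ℝ) :
    Tendsto (fun n : ℕ => u / √(n : ℝ)) atTop (nhds 0) :=
  (Real.tendsto_sqrt_atTop.comp tendsto_natCast_atTop_atTop).const_div_atTop u

lemma tendsto_cos_pow (u : ℝ) :
    Tendsto (fun n : ℕ => ((1 + 2 * Real.cos (u / √n)) / 3) ^ n) atTop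
      (nhds (Real.exp (-(1 / 3) * u ^ 2))) := by
  have hg : Tendsto (fun n : ℕ => (n : ℝ) * (2 / 3 * (Real.cos (u / √n) - 1))) atTop
      (nhds (-(1 / 3) * u ^ 2)) := by
    rw [tendsto_iff_norm_sub_tendsto_zero]
    refine squeeze_zero' (Eventually.of_forall fun _ => norm_nonneg _) (g := fun n : ℕ =>
      u ^ 4 / n) ?_ (tendsto_const_div_atTop_nhds_zero_nat _)
    have h1 : ∀ᶠ n : ℕ in atTop, |u / √n| < 1 := by
      have := (tendsto_div_sqrt_natCast u).abs
      rw [abs_zero] at this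
      exact this.eventually_lt_const one_pos
    filter_upwards [h1, eventually_ge_atTop 1] with n hn hn1
    have hn0 : (0 : ℝ) < n := by exact_mod_cast hn1
    have hb := Real.cos_bound hn.le
    have hx2 : (u / √n) ^ 2 = u ^ 2 / n := by rw [div_pow, Real.sq_sqrt hn0.le]
    have hx4 : |u / √n| ^ 4 = u ^ 4 / n ^ 2 := by
      rw [show |u / √n| ^ 4 = ((u / √n) ^ 2) ^ 2 by
          rw [← sq_abs (u / √n)]; ring, hx2]
      ring
    rw [hx2, hx4] at hb
    have e : (n : ℝ) * (2 / 3 * (Real.cos (u / √n) - 1)) - -(1 / 3) * u ^ 2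
        = (2 / 3 * n) * (Real.cos (u / √n) - (1 - u ^ 2 / n / 2)) := by
      field_simp
      ring
    rw [e, Real.norm_eq_abs, abs_mul, abs_of_pos (by positivity)]
    calc _ ≤ (2 / 3 * (n : ℝ)) * (u ^ 4 / n ^ 2 * (5 / 96)) := by gcongr
      _ = (5 / 144) * (u ^ 4 / n) := by field_simp; ring
      _ ≤ 1 * (u ^ 4 / n) := by gcongr; norm_num
      _ = _ := one_mul _
  refine (Real.tendsto_one_add_pow_exp_of_tendsto hg).congr fun n => ?_
  congr 1
  ring

lemma tendsto_walkKernel (j : ℤ) (u : ℝ) :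
    Tendsto (fun n => walkKernel j n u) atTop (nhds (Real.exp (-(1 / 3) * u ^ 2))) := by
  have h0 := tendsto_div_sqrt_natCast u
  have h1 : ∀ᶠ n : ℕ in atTop, u / √n ∈ Set.Ioc (-Real.pi) Real.pi :=
    h0.eventually (Ioc_mem_nhds (by linarith [Real.pi_pos]) Real.pi_pos)
  have h2 : Tendsto (fun n : ℕ => Real.cos (j * (u / √n))) atTop (nhds 1) := by
    have := (Real.continuous_cos.tendsto _).comp (h0.const_mul (j : ℝ))
    simpa [Function.comp_def] using this
  have h3 := (tendsto_cos_pow u).mul h2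
  rw [mul_one] at h3
  refine h3.congr' ?_
  filter_upwards [h1] with n hn
  rw [walkKernel, Set.indicator_of_mem hn]

lemma measurable_walkKernel (j : ℤ) (n : ℕ) : Measurable (walkKernel j n) := by
  refine Measurable.comp (g := Set.indicator _ _) ?_ (measurable_id.div_const _)
  exact Measurable.indicator (by fun_prop) measurableSet_Ioc

theorem tendsto_walkCount (j : ℤ) :
    Tendsto (fun n : ℕ => (walkCount n j : ℝ) * √n / 3 ^ n) atTop
      (nhds (√3 / (2 * √Real.pi))) := by
  have hpi := Real.pi_pos
  have h := MeasureTheory.tendsto_integral_filter_of_dominated_convergence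
    (μ := MeasureTheory.volume) (l := atTop) (F := fun n => walkKernel j n)
    (f := fun u => Real.exp (-(1 / 3) * u ^ 2))
    (fun u => Real.exp (-(2 / (3 * Real.pi ^ 2)) * u ^ 2))
    (Eventually.of_forall fun n => (measurable_walkKernel j n).aestronglyMeasurable)
    (by
      filter_upwards [eventually_ge_atTop 1] with n hn
      exact Eventually.of_forall (norm_walkKernel_le j hn))
    (integrable_exp_neg_mul_sq (by positivity))
    (Eventually.of_forall (tendsto_walkKernel j))
  rw [integral_gaussian] at h
  simp only [integral_walkKernel] at h
  have h2 := h.const_mul (2 * Real.pi)⁻¹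
  have e : (2 * Real.pi)⁻¹ * √(Real.pi / (1 / 3)) = √3 / (2 * √Real.pi) := by
    rw [show Real.pi / (1 / 3) = 3 * Real.pi by ring, Real.sqrt_mul (by norm_num)]
    have hs : √Real.pi ≠ 0 := by positivity
    have hs2 := Real.mul_self_sqrt hpi.le
    field_simp
    rw [sq, hs2]
  rw [e] at h2
  refine h2.congr fun n => ?_
  field_simp

lemma tendsto_sqrt_succ_div_sqrt :
    Tendsto (fun n : ℕ => √((n + 1 : ℕ) : ℝ) / √(n : ℝ)) atTop (nhds 1) := by
  have h := (tendsto_natCast_div_add_atTop (1 : ℝ)).inv₀ one_ne_zero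
  have h2 := (Real.continuous_sqrt.tendsto _).comp h
  simp only [inv_one, Real.sqrt_one] at h2
  refine h2.congr fun n => ?_
  simp only [Function.comp_apply, inv_div]
  rw [Real.sqrt_div (by positivity)]
  push_cast
  rfl

lemma tendsto_hasseEdges :
    Tendsto (fun n : ℕ => (hasseEdges (MotzkinPath n) : ℝ) * √n / 3 ^ n) atTop
      (nhds (4 / 3 * (√3 / (2 * √Real.pi)))) := by
  rw [← tendsto_add_atTop_iff_nat 1]
  have h1 := (tendsto_add_atTop_iff_nat 1).2 (tendsto_walkCount 2)
  have h2 := ((tendsto_walkCount 2).mul tendsto_sqrt_succ_div_sqrt).div_const 3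
  have h3 := h1.add h2
  -- The factor `4/3 = 1 + 1/3` comes from `w(n + 1, 2)` and `w(n, 2)`, the latter being one power
  -- of `3` behind.
  rw [show √3 / (2 * √Real.pi) + √3 / (2 * √Real.pi) * 1 / 3
    = 4 / 3 * (√3 / (2 * √Real.pi)) by ring] at h3
  refine h3.congr' ?_
  filter_upwards [eventually_ge_atTop 1] with n hn
  have hn0 : (0 : ℝ) < n := by exact_mod_cast hn
  have hs : √(n : ℝ) ≠ 0 := by positivity
  have hl : (hasseEdges (MotzkinPath (n + 1)) : ℝ) = walkCount (n + 1) 2 + walkCount n 2 := by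
    exact_mod_cast hasseEdges_succ n
  rw [hl, pow_succ]
  field_simp

lemma tendsto_motzkinNumber :
    Tendsto (fun n : ℕ => (motzkinNumber n : ℝ) * (n + 1) * √((n + 1 : ℕ) : ℝ) / 3 ^ (n + 1)) atTop
      (nhds (√3 / (2 * √Real.pi))) := by
  refine ((tendsto_add_atTop_iff_nat 1).2 (tendsto_walkCount 1)).congr fun n => ?_
  have : ((n : ℝ) + 1) * motzkinNumber n = walkCount (n + 1) 1 := by
    have := succ_mul_ballot_zero n
    rw [← motzkinNumber_eq_ballot] at this
    exact_mod_cast this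
  rw [← this]
  ring

theorem hasseEdges_isEquivalent :
    (fun n : ℕ => (hasseEdges (MotzkinPath n) : ℝ)) ~[atTop]
      fun n : ℕ => 2 * (3 : ℝ) ^ n / Real.sqrt (3 * (n : ℝ) * Real.pi) := by
  have hpi := Real.pi_pos
  refine isEquivalent_of_tendsto_one ?_
  have h := tendsto_hasseEdges.mul_const (√3 * √Real.pi / 2)
  have h3 : √3 * √3 = (3 : ℝ) := Real.mul_self_sqrt (by norm_num)
  have hs : √Real.pi ≠ 0 := by positivity
  rw [show 4 / 3 * (√3 / (2 * √Real.pi)) * (√3 * √Real.pi / 2) = 1 by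
    field_simp; rw [sq, h3]; norm_num] at h
  refine h.congr fun n => ?_
  rw [Pi.div_apply, Real.sqrt_mul (by positivity), Real.sqrt_mul (by norm_num)]
  rw [div_div_eq_mul_div]
  field_simp

theorem hasseIndex_isEquivalent : (fun n : ℕ => hasseIndex (MotzkinPath n)) ~[atTop]
    fun n : ℕ => (4 / 9 : ℝ) * (n : ℝ) := by
  have hpi := Real.pi_pos
  refine isEquivalent_of_tendsto_one ?_
  have hc : √3 / (2 * √Real.pi) ≠ 0 := by positivity
  have h1 := tendsto_hasseEdges.div tendsto_motzkinNumber hc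
  have h2 := (tendsto_natCast_div_add_atTop (1 : ℝ)).inv₀ one_ne_zero
  -- The Motzkin limit is normalised at `n + 1`: the extra factors turn `(n + 1) √(n + 1)` into `n
  -- √n`, and `3/4` inverts the limit `4/3`.
  have h := ((h1.mul tendsto_sqrt_succ_div_sqrt).mul h2).mul_const (3 / 4)
  rw [mul_div_cancel_right₀ _ hc, inv_one, show (4 / 3 * 1 * 1 * (3 / 4) : ℝ) = 1 by norm_num] at h
  refine h.congr' ?_
  filter_upwards [eventually_ge_atTop 1] with n hn
  have hn0 : (0 : ℝ) < n := by exact_mod_cast hn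
  have hs : √(n : ℝ) ≠ 0 := by positivity
  have hs1 : √((n + 1 : ℕ) : ℝ) ≠ 0 := by positivity
  have hn1 : (n : ℝ) + 1 ≠ 0 := by positivity
  simp only [Pi.div_apply, hasseIndex, ← motzkinNumber.eq_1]
  rw [pow_succ]
  rcases eq_or_ne (motzkinNumber n : ℝ) 0 with h0 | h0
  · simp [h0]
  · field_simp
    norm_num

theorem asymptoticallyQuasiBoolean_motzkinPath : AsymptoticallyQuasiBoolean MotzkinPath := by
  refine ⟨1 / 18, by norm_num, by norm_num, Or.inr ?_⟩
  rw [show (1 / 2 - 1 / 18 : ℝ) = 4 / 9 by norm_num]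
  exact hasseIndex_isEquivalent

/-- In the first conjunct `S` is the formal power series `√(1 - 2x - 3x²)`, and the quotient is
taken in the field of formal Laurent series. -/
theorem mainTheorem3 :
    (∃ S : ℚ⟦X⟧, PowerSeries.constantCoeff S = 1 ∧
      S ^ 2 = 1 - 2 * PowerSeries.X - 3 * PowerSeries.X ^ 2 ∧
      (edgeSeries MotzkinPath : ℚ⸨X⸩) =
        (((1 + PowerSeries.X) * (1 - 2 * PowerSeries.X - PowerSeries.X ^ 2
            - (1 - PowerSeries.X) * S) : ℚ⟦X⟧) : ℚ⸨X⸩) /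
          ((2 * PowerSeries.X ^ 2 * S : ℚ⟦X⟧) : ℚ⸨X⸩)) ∧
    edgeSeries MotzkinPath =
      (1 + PowerSeries.X) * (centralTrinomialSeries - motzkinSeries) ∧
    (∀ n : ℕ, 1 ≤ n →
      (hasseEdges (MotzkinPath n) : ℤ) =
        (trinomialCoeff n n : ℤ) - (motzkinNumber n : ℤ)
          + (trinomialCoeff (n - 1) (n - 1) : ℤ) - (motzkinNumber (n - 1) : ℤ)) ∧
    (∀ n : ℕ, 3 ≤ n →
      hasseEdges (MotzkinPath n) =
        trinomialCoeff n (n - 2) + trinomialCoeff (n - 1) (n - 3)) ∧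
    (∀ n : ℕ, 1 ≤ n →
      (hasseEdges (MotzkinPath n) : ℚ) =
        (2 / (n : ℚ)) * ∑ k ∈ Finset.range (n / 2 + 1),
          (n.choose k : ℚ) * ((n - k).choose k : ℚ)
            * (((k : ℚ) * ((n : ℚ) - (k : ℚ))) / ((k : ℚ) + 1))) ∧
    ((fun n : ℕ => (hasseEdges (MotzkinPath n) : ℝ)) ~[atTop]
      fun n : ℕ => 2 * (3 : ℝ) ^ n / Real.sqrt (3 * (n : ℝ) * Real.pi)) ∧
    ((fun n : ℕ => hasseIndex (MotzkinPath n)) ~[atTop] fun n : ℕ => (4 / 9 : ℝ) * (n : ℝ)) ∧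
    AsymptoticallyQuasiBoolean MotzkinPath := by
  exact ⟨⟨sqrtSeries, constantCoeff_sqrtSeries, sqrtSeries_sq, edgeSeries_eq_div⟩, edgeSeries_eq,
    fun _ => hasseEdges_eq_central, fun _ => hasseEdges_eq_trinomialCoeff,
    fun _ => hasseEdges_eq_sum_choose, hasseEdges_isEquivalent, hasseIndex_isEquivalent,
    asymptoticallyQuasiBoolean_motzkinPath⟩
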